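/- Let $E$ be a real AL-space, that is, a real Banach lattice whose norm is additive on the positive cone: $\|f+g\|=\|f\|+\|g\|$ for all $f,g\in E_+$. Let $J=\mathbb{N}=\{1,2,\dots\}$ or $J=(0,\infty)$, and let $(T_t)_{t\in J}$ be a bounded semigroup on $E$, that is, a family of bounded linear operators on $E$ with $T_{s+t}=T_sT_t$ for all $s,t\in J$ and $\sup_{t\in J}\|T_t\|<\infty$ (no continuity in $t$ is required). Then the following assertions are equivalent: (i) There exist $f_0\in E_+$ with $\|f_0\|=1$ and $T_tf_0=f_0$ for all $t\in J$, and a positive functional $\varphi\in E'$ with $T_t'\varphi=\varphi$ for all $t\in J$, with $\langle\varphi,f_0\rangle=1$, and such that for some constant $\varepsilon>0$ one has $\langle\varphi,f\rangle\ge\varepsilon$ for all $f\in E_+$ with $\|f\|=1$, such that $T_t$ converges in operator norm, as $t\to\infty$, to the rank-one projection $\varphi\otimes f_0\colon g\mapsto\langle\varphi,g\rangle f_0$. (ii) There exists a vector $h\in E$ with $h\ge 0$ and $h\neq 0$ such that $$\lim_{t\to\infty}\ \sup\bigl\{\|(T_tf-h)^-\| : f\in E_+,\ \|f\|=1\bigr\}=0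 .$$ -/

import Mathlib

open Filter Topology

/-- Additivity of the norm on the positive cone. A Banach lattice with this property is an
AL-space. -/
class IsALSpace (E : Type*) [NormedAddCommGroup E] [Lattice E] : Prop where
  norm_add_of_nonneg : ∀ f g : E, 0 ≤ f → 0 ≤ g → ‖f + g‖ = ‖f‖ + ‖g‖

/-- A bounded semigroup of bounded linear operators over the time set `J`: the semigroup law
holds and the operator norms have a finite supremum. No continuity in `t` and no positivity of
the operators is required. -/
structure IsBoundedSemigroup {J E : Type*} [Add J] [NormedAddCommGroup E] [NormedSpace ℝ E]
    (T : J → E →L[ℝ] E) : Prop where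
  map_add : ∀ s t : J, T (s + t) = (T s).comp (T t)
  bddAbove_norm : BddAbove (Set.range fun t => ‖T t‖)

/-- The semigroup converges in operator norm, as `t → ∞`, to the rank-one projection
`φ ⊗ f₀ : g ↦ φ(g) f₀`, where `f₀` is a positive normalised fixed vector and `φ` is a positive
fixed functional with `φ(f₀) = 1` that is bounded below by some `ε > 0` on the normalised positive
vectors. -/
def ConvergesInNormToRankOne {J E : Type*} [Preorder J] [NormedAddCommGroup E] [NormedSpace ℝ E]
    [Lattice E] (T : J → E →L[ℝ] E) : Prop :=
  ∃ (f₀ : E) (φ : E →L[ℝ] ℝ),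
    0 ≤ f₀ ∧ ‖f₀‖ = 1 ∧ (∀ t, T t f₀ = f₀) ∧
    (∀ f, 0 ≤ f → 0 ≤ φ f) ∧ (∀ t, φ.comp (T t) = φ) ∧
    φ f₀ = 1 ∧
    (∃ ε : ℝ, 0 < ε ∧ ∀ f, 0 ≤ f → ‖f‖ = 1 → ε ≤ φ f) ∧
    Tendsto T atTop (𝓝 (φ.smulRight f₀))

/-- There is `h > 0` (that is, `h ≥ 0` and `h ≠ 0`) which is a lower bound for the semigroup
uniformly over the normalised positive vectors. For a bounded semigroup the set below is bounded
above, since `‖x⁻‖ ≤ ‖x‖`; it is nonempty because `h ≠ 0` forces `E ≠ {0}`. -/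
def HasUniformLowerBound {J E : Type*} [Preorder J] [NormedAddCommGroup E] [NormedSpace ℝ E]
    [Lattice E] (T : J → E →L[ℝ] E) : Prop :=
  ∃ h : E, 0 < h ∧
    Tendsto (fun t => sSup {r : ℝ | ∃ f : E, 0 ≤ f ∧ ‖f‖ = 1 ∧ r = ‖(T t f - h)⁻‖}) atTop (𝓝 0)

/-! Only (ii) ⇒ (i) is deep; it is a Doeblin argument for the powers of `S = T 1`. On an AL-space
the norm of positive vectors extends to a linear functional `I`. Averaging `I ∘ S ^ k` gives an
invariant `φ`, and the lower bound `h` forces `φ f ≥ ‖h‖ / 2 * ‖f‖` on the cone, so `φ |x|` is an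
equivalent norm. If `φ x = 0`, then `x⁺` and `x⁻` have equal mass; their images under a high power
of `S` almost dominate the same multiple of `h`, which cancels in the difference. So that power
contracts `ker φ` strictly (`eventually_norm_pow_apply_le_of_ker`). Orbits of vectors with `φ = 1`
then converge to a fixed vector, and splitting off `ker φ` gives norm convergence.

For real times, the semigroup commutes with the limit projection, so it acts on the range by a
bounded multiplicative scalar, which must be 1 (`posReal_fixed`). -/

section LatticeGroup

variable {E : Type*} [AddCommGroup E] [Lattice E] [IsOrderedAddMonoid E]

theorem negPart_le_of_le_add {x e y : E} (he : 0 ≤ e) (h : y ≤ x + e) : (x - y)⁻ ≤ e := by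
  rw [negPart_def]
  refine sup_le ?_ he
  rw [neg_sub]
  exact sub_le_iff_le_add'.2 h

/-- A perturbation of `|x - y| ≤ x + y` for positive vectors; `e` and `d` make up for the missing
positivity of `S`. -/
theorem abs_sub_le_of_nonneg_add {x y e d : E} (he : 0 ≤ e) (hd : 0 ≤ d) (hx : 0 ≤ x + e)
    (hy : 0 ≤ y + d) : |x - y| ≤ (x + e) + (y + d) + e + d := by
  have key : ∀ {a b e d : E}, 0 ≤ e → 0 ≤ d → 0 ≤ a + e → 0 ≤ b + d →
      a - b ≤ (a + e) + (b + d) + e + d := by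
    intro a b e d he hd _ hb
    have h1 : a - b = (a + e) + (b + d) + e + d - ((b + d) + (b + d) + (e + e)) := by abel
    rw [h1]
    exact sub_le_self _ (add_nonneg (add_nonneg hb hb) (add_nonneg he he))
  refine abs_le'.2 ⟨key he hd hx hy, ?_⟩
  rw [neg_sub]
  refine (key hd he hy hx).trans (le_of_eq ?_)
  abel

end LatticeGroup

section SolidNorm

variable {E : Type*} [NormedAddCommGroup E] [Lattice E] [IsOrderedAddMonoid E] [HasSolidNorm E]

theorem norm_le_norm_of_nonneg_of_le {a b : E} (ha : 0 ≤ a) (hab : a ≤ b) : ‖a‖ ≤ ‖b‖ :=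
  HasSolidNorm.solid (by rwa [abs_of_nonneg ha, abs_of_nonneg (ha.trans hab)])

theorem norm_negPart_le (x : E) : ‖x⁻‖ ≤ ‖x‖ := by
  rw [← norm_abs_eq_norm x, ← posPart_add_negPart]
  exact norm_le_norm_of_nonneg_of_le (negPart_nonneg x)
    (le_add_of_nonneg_left (posPart_nonneg x))

end SolidNorm

/-! ### Asymptotic lower bounds -/

section LowerBounds

variable {E : Type*} [NormedAddCommGroup E] [NormedSpace ℝ E] [Lattice E]

/-- Along the filter `l`, the operators `u i` satisfy `u i f ≥ ‖f‖ • h` for all `f ≥ 0`, up to an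
error that is small relative to `‖f‖`. -/
def AsymptoticLowerBound {ι : Type*} (u : ι → E →L[ℝ] E) (l : Filter ι) (h : E) : Prop :=
  ∀ ε : ℝ, 0 < ε → ∀ᶠ i in l, ∀ f : E, 0 ≤ f →
    ∃ e : E, 0 ≤ e ∧ ‖e‖ ≤ ε * ‖f‖ ∧ ‖f‖ • h ≤ u i f + e

variable [IsOrderedAddMonoid E] [HasSolidNorm E]

theorem AsymptoticLowerBound.of_tendsto_sSup [IsOrderedModule ℝ E] {J : Type*} {l : Filter J}
    {T : J → E →L[ℝ] E} {M : ℝ} (hM : ∀ t, ‖T t‖ ≤ M) {h : E}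
    (hlim : Tendsto (fun t => sSup {r : ℝ | ∃ f : E, 0 ≤ f ∧ ‖f‖ = 1 ∧ r = ‖(T t f - h)⁻‖}) l
      (𝓝 0)) :
    AsymptoticLowerBound T l h := by
  intro ε hε
  filter_upwards [hlim.eventually (gt_mem_nhds hε)] with t ht f hf
  rcases eq_or_ne f 0 with rfl | hf0
  · exact ⟨0, le_rfl, by simp, by simp⟩
  have hfn : 0 < ‖f‖ := norm_pos_iff.2 hf0
  set g : E := ‖f‖⁻¹ • f with hg
  have hg0 : 0 ≤ g := smul_nonneg (inv_nonneg.2 hfn.le) hf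
  have hg1 : ‖g‖ = 1 := by
    rw [hg, norm_smul, norm_inv, norm_norm, inv_mul_cancel₀ hfn.ne']
  have hfg : f = ‖f‖ • g := by rw [hg, smul_smul, mul_inv_cancel₀ hfn.ne', one_smul]
  -- On an unbounded set `sSup` would be 0 and carry no information.
  have hbdd : BddAbove {r : ℝ | ∃ f : E, 0 ≤ f ∧ ‖f‖ = 1 ∧ r = ‖(T t f - h)⁻‖} := by
    refine ⟨M + ‖h‖, ?_⟩
    rintro r ⟨f, -, hf1, rfl⟩
    have h1 := (T t).le_of_opNorm_le (hM t) f
    rw [hf1, mul_one] at h1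
    linarith [norm_negPart_le (T t f - h), norm_sub_le (T t f) h]
  have hle : ‖(T t g - h)⁻‖ ≤ ε := (le_csSup hbdd ⟨g, hg0, hg1, rfl⟩).trans ht.le
  refine ⟨‖f‖ • (T t g - h)⁻, smul_nonneg hfn.le (negPart_nonneg _), ?_, ?_⟩
  · rw [norm_smul, norm_norm, mul_comm]
    exact mul_le_mul_of_nonneg_right hle hfn.le
  · have h1 : T t f = ‖f‖ • T t g := by
      conv_lhs => rw [hfg]
      rw [map_smul]
    rw [h1, ← smul_add]
    refine smul_le_smul_of_nonneg_left ?_ hfn.le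
    have h2 := neg_le_negPart (T t g - h)
    rw [neg_sub] at h2
    exact sub_le_iff_le_add'.1 h2

theorem ConvergesInNormToRankOne.hasUniformLowerBound [IsOrderedModule ℝ E] {J : Type*}
    [Preorder J] {T : J → E →L[ℝ] E} (hT : ConvergesInNormToRankOne T) :
    HasUniformLowerBound T := by
  obtain ⟨f₀, φ, hf₀, hf₁, -, -, -, -, ⟨ε, hε, hφε⟩, hlim⟩ := hT
  have hf₀ne : f₀ ≠ 0 := fun h0 => by simp [h0] at hf₁
  refine ⟨ε • f₀, (smul_nonneg hε.le hf₀).lt_of_ne (smul_ne_zero hε.ne' hf₀ne).symm, ?_⟩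
  refine squeeze_zero (fun t => Real.sSup_nonneg ?_) (fun t => Real.sSup_le ?_ (norm_nonneg _))
    (tendsto_iff_norm_sub_tendsto_zero.1 hlim)
  · rintro r ⟨f, -, -, rfl⟩
    exact norm_nonneg _
  · rintro r ⟨f, hf, hfn, rfl⟩
    have h1 : ‖T t f - φ f • f₀‖ ≤ ‖T t - φ.smulRight f₀‖ := by
      have := (T t - φ.smulRight f₀).le_opNorm f
      rwa [hfn, mul_one] at this
    refine le_trans ?_ ((norm_negPart_le _).trans h1)
    refine norm_le_norm_of_nonneg_of_le (negPart_nonneg _) (negPart_anti ?_)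
    exact sub_le_sub_left (smul_le_smul_of_nonneg_right (hφε f hf hfn) hf₀) _

end LowerBounds

/-! ### The norm as a linear functional -/

section NormFunctional

variable (E : Type*) [NormedAddCommGroup E] [NormedSpace ℝ E] [Lattice E] [IsOrderedAddMonoid E]
  [HasSolidNorm E] [IsALSpace E]

/-- The continuous linear functional on an AL-space that agrees with the norm on the positive
cone. -/
noncomputable def alFunctional : E →L[ℝ] ℝ :=
  AddMonoidHom.toRealLinearMap
    { toFun := fun x => ‖x⁺‖ - ‖x⁻‖
      map_zero' := by simp
      map_add' := fun x y => by
        -- Rearranged so that both sides are sums of positive vectors, where the norm is additive.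
        have h : (x + y)⁺ + (x⁻ + y⁻) = (x + y)⁻ + (x⁺ + y⁺) := by
          have hx := posPart_sub_negPart x
          have hy := posPart_sub_negPart y
          have hxy := posPart_sub_negPart (x + y)
          rw [← sub_eq_zero]
          calc (x + y)⁺ + (x⁻ + y⁻) - ((x + y)⁻ + (x⁺ + y⁺))
              = ((x + y)⁺ - (x + y)⁻) - ((x⁺ - x⁻) + (y⁺ - y⁻)) := by abel
            _ = 0 := by rw [hx, hy, hxy, sub_self]
        have h2 := congrArg norm h
        simp only [IsALSpace.norm_add_of_nonneg _ _ (posPart_nonneg (x + y))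
            (add_nonneg (negPart_nonneg x) (negPart_nonneg y)),
          IsALSpace.norm_add_of_nonneg _ _ (negPart_nonneg (x + y))
            (add_nonneg (posPart_nonneg x) (posPart_nonneg y)),
          IsALSpace.norm_add_of_nonneg _ _ (posPart_nonneg x) (posPart_nonneg y),
          IsALSpace.norm_add_of_nonneg _ _ (negPart_nonneg x) (negPart_nonneg y)] at h2
        linarith }
    ((continuous_posPart.norm).sub (continuous_negPart.norm))

variable {E}

theorem alFunctional_of_nonneg {x : E} (hx : 0 ≤ x) : alFunctional E x = ‖x‖ := by
  change ‖x⁺‖ - ‖x⁻‖ = ‖x‖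
  rw [posPart_of_nonneg hx, negPart_of_nonneg hx, norm_zero, sub_zero]

end NormFunctional

/-! ### Invariant functionals and limits of powers -/

section Powers

variable {E : Type*} [NormedAddCommGroup E] [NormedSpace ℝ E]

theorem sum_range_pow_shift_sub (I : E →L[ℝ] ℝ) (S : E →L[ℝ] E) (n : ℕ) (x : E) :
    ∑ k ∈ Finset.range n, I ((S ^ (n + k)) (S x)) - ∑ k ∈ Finset.range n, I ((S ^ (n + k)) x)
      = I ((S ^ (n + n)) x) - I ((S ^ n) x) := by
  rw [← Finset.sum_sub_distrib]
  have h := Finset.sum_range_sub (fun k => I ((S ^ (n + k)) x)) n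
  rw [add_zero] at h
  rw [← h]
  refine Finset.sum_congr rfl fun k _ => ?_
  rw [← add_assoc, pow_succ]
  rfl

/-- A weak-* limit of the means `n⁻¹ ∑_{n ≤ k < 2n} I ∘ S ^ k` is an invariant functional; it
inherits lower bounds that hold eventually for `I ∘ S ^ n`. -/
theorem exists_invariant_functional (I : E →L[ℝ] ℝ) (S : E →L[ℝ] E) {M : ℝ}
    (hM : ∀ n, ‖S ^ n‖ ≤ M) :
    ∃ φ : E →L[ℝ] ℝ, φ.comp S = φ ∧
      ∀ (x : E) (c : ℝ), (∀ᶠ n in atTop, c ≤ I ((S ^ n) x)) → c ≤ φ x := by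
  have hM0 : 0 ≤ M := (norm_nonneg _).trans (hM 0)
  have hI : ∀ n x, ‖I ((S ^ n) x)‖ ≤ ‖I‖ * M * ‖x‖ := fun n x => by
    rw [mul_assoc]
    exact (I.le_opNorm _).trans
      (mul_le_mul_of_nonneg_left ((S ^ n).le_of_opNorm_le (hM n) x) (norm_nonneg _))
  -- The window starts at `n`, so a bound valid from some index on holds for every summand once `n`
  -- is large.
  let ψ : ℕ → E →L[ℝ] ℝ := fun n => (n : ℝ)⁻¹ • ∑ k ∈ Finset.range n, I.comp (S ^ (n + k))
  have hψ : ∀ n x, ψ n x = (n : ℝ)⁻¹ * ∑ k ∈ Finset.range n, I ((S ^ (n + k)) x) := by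
    intro n x
    simp [ψ]
  have hψn : ∀ n, ‖ψ n‖ ≤ ‖I‖ * M := by
    intro n
    refine ContinuousLinearMap.opNorm_le_bound _ (by positivity) fun x => ?_
    rw [hψ, norm_mul, norm_inv, RCLike.norm_natCast]
    have h1 : ‖∑ k ∈ Finset.range n, I ((S ^ (n + k)) x)‖ ≤ n * (‖I‖ * M * ‖x‖) := by
      refine (norm_sum_le_of_le _ fun k _ => hI (n + k) x).trans ?_
      simp
    refine (mul_le_mul_of_nonneg_left h1 (by positivity)).trans ?_
    rcases Nat.eq_zero_or_pos n with rfl | hn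
    · simp only [Nat.cast_zero, inv_zero, zero_mul]; positivity
    · rw [inv_mul_cancel_left₀ (by positivity)]
  let U : Ultrafilter ℕ := Filter.hyperfilter ℕ
  have hU : (U : Filter ℕ) ≤ atTop := Nat.hyperfilter_le_atTop
  obtain ⟨φ, -, hφ⟩ := (WeakDual.isCompact_closedBall (𝕜 := ℝ) (E := E) 0
    (‖I‖ * M)).ultrafilter_le_nhds (U.map fun n => StrongDual.toWeakDual (ψ n)) (by
      rw [le_principal_iff]
      refine Filter.mem_map.2 (Filter.univ_mem' fun n => ?_)
      simpa using hψn n)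
  have hlim : ∀ x, Tendsto (fun n => ψ n x) U (𝓝 (φ x)) := fun x =>
    ((WeakDual.eval_continuous x).tendsto φ).comp (f := fun n => StrongDual.toWeakDual (ψ n)) hφ
  refine ⟨WeakDual.toStrongDual φ, ?_, ?_⟩
  · ext x
    change φ (S x) = φ x
    refine sub_eq_zero.1 (tendsto_nhds_unique ((hlim (S x)).sub (hlim x)) ?_)
    refine Tendsto.mono_left ?_ hU
    refine squeeze_zero_norm (a := fun n : ℕ => (n : ℝ)⁻¹ * (2 * (‖I‖ * M * ‖x‖))) (fun n => ?_) ?_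
    · rw [hψ, hψ, ← mul_sub, sum_range_pow_shift_sub, norm_mul, norm_inv, RCLike.norm_natCast]
      refine mul_le_mul_of_nonneg_left ?_ (by positivity)
      refine (norm_sub_le _ _).trans ?_
      linarith [hI (n + n) x, hI n x]
    · simpa using tendsto_inv_atTop_nhds_zero_nat.mul_const (2 * (‖I‖ * M * ‖x‖))
  · intro x c hc
    change c ≤ φ x
    refine ge_of_tendsto (hlim x) (hU ?_)
    obtain ⟨N, hN⟩ := eventually_atTop.1 hc
    filter_upwards [eventually_ge_atTop N, eventually_gt_atTop 0] with n hn hn0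
    rw [hψ, le_inv_mul_iff₀ (by exact_mod_cast hn0)]
    have := Finset.card_nsmul_le_sum (Finset.range n) (fun k => I ((S ^ (n + k)) x)) c
      fun k _ => hN _ (by omega)
    simpa using this

theorem apply_pow_of_comp_eq {φ : E →L[ℝ] ℝ} {S : E →L[ℝ] E} (hφS : φ.comp S = φ) (n : ℕ)
    (x : E) : φ ((S ^ n) x) = φ x := by
  induction n with
  | zero => rfl
  | succ n ih =>
    rw [pow_succ']
    exact (DFunLike.congr_fun hφS ((S ^ n) x)).trans ih

theorem pow_apply_of_apply_eq {S : E →L[ℝ] E} {f : E} (hf : S f = f) (n : ℕ) :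
    (S ^ n) f = f := by
  induction n with
  | zero => rfl
  | succ n ih => rw [pow_succ]; exact (congrArg _ hf).trans ih

theorem tendsto_pow_apply {S : E →L[ℝ] E} {f₀ : E} {φ : E →L[ℝ] ℝ}
    (hlim : Tendsto (fun n : ℕ => S ^ n) atTop (𝓝 (φ.smulRight f₀))) (x : E) :
    Tendsto (fun n : ℕ => (S ^ n) x) atTop (𝓝 (φ x • f₀)) :=
  ((ContinuousLinearMap.apply ℝ E x).continuous.tendsto _).comp hlim

/-- Pass to the limit in `S * S ^ n = S ^ (n + 1) = S ^ n * S`. -/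
theorem fixed_of_tendsto_pow_rankOne {S : E →L[ℝ] E} {f₀ : E} {φ : E →L[ℝ] ℝ} (hφf₀ : φ f₀ = 1)
    (hlim : Tendsto (fun n : ℕ => S ^ n) atTop (𝓝 (φ.smulRight f₀))) :
    S f₀ = f₀ ∧ φ.comp S = φ := by
  have hsucc := fun x => (tendsto_add_atTop_iff_nat 1).2 (tendsto_pow_apply hlim x)
  constructor
  · have h1 := (S.continuous.tendsto _).comp (tendsto_pow_apply hlim f₀)
    have h2 := hsucc f₀
    rw [hφf₀, one_smul] at h1 h2
    refine tendsto_nhds_unique h1 (h2.congr fun n => ?_)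
    rw [pow_succ']
    rfl
  · ext x
    have h1 : φ (S x) • f₀ = φ x • f₀ :=
      tendsto_nhds_unique (tendsto_pow_apply hlim (S x)) ((hsucc x).congr fun n => by
        rw [pow_succ]
        rfl)
    have h2 := congrArg φ h1
    simpa [hφf₀] using h2

end Powers

/-! ### Convergence of powers on an AL-space -/

section PowerConvergence

variable {E : Type*} [NormedAddCommGroup E] [NormedSpace ℝ E] [Lattice E]
  [IsOrderedAddMonoid E] [HasSolidNorm E]

/-- Apply `alFunctional` to the positive vector `(S ^ n) f + e - ‖f‖ • h`; the error `e` costs at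
most half of `‖h‖ * ‖f‖`. -/
theorem exists_invariant_functional_of_asymptoticLowerBound [IsALSpace E] {S : E →L[ℝ] E}
    {M : ℝ} (hM : ∀ n, ‖S ^ n‖ ≤ M) {h : E} (hh : 0 < h)
    (hS : AsymptoticLowerBound (fun n : ℕ => S ^ n) atTop h) :
    ∃ φ : E →L[ℝ] ℝ, φ.comp S = φ ∧ ∀ f, 0 ≤ f → ‖h‖ / 2 * ‖f‖ ≤ φ f := by
  obtain ⟨φ, hφS, hφ⟩ := exists_invariant_functional (alFunctional E) S hM
  refine ⟨φ, hφS, fun f hf => hφ f _ ?_⟩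
  have hhn : 0 < ‖h‖ := norm_pos_iff.2 hh.ne'
  filter_upwards [hS (‖h‖ / 2) (half_pos hhn)] with n hn
  obtain ⟨e, he, hen, hle⟩ := hn f hf
  have h1 : 0 ≤ (S ^ n) f + e - ‖f‖ • h := sub_nonneg.2 hle
  have h2 := norm_nonneg ((S ^ n) f + e - ‖f‖ • h)
  rw [← alFunctional_of_nonneg h1, map_sub, map_add, alFunctional_of_nonneg he, map_smul,
    alFunctional_of_nonneg hh.le, smul_eq_mul] at h2
  linarith

variable [IsOrderedModule ℝ E]

/-- On the kernel of a strictly positive invariant functional, the powers of `S` tend to zero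
uniformly: they are eventually strict contractions for the norm `x ↦ φ |x|`. -/
theorem eventually_norm_pow_apply_le_of_ker {S : E →L[ℝ] E} {M : ℝ} (hM : ∀ n, ‖S ^ n‖ ≤ M)
    {h : E} (hh : 0 < h) (hS : AsymptoticLowerBound (fun n : ℕ => S ^ n) atTop h)
    {φ : E →L[ℝ] ℝ} (hφS : φ.comp S = φ) {δ : ℝ} (hδ : 0 < δ)
    (hφδ : ∀ f, 0 ≤ f → δ * ‖f‖ ≤ φ f) {ε : ℝ} (hε : 0 < ε) :
    ∀ᶠ n in atTop, ∀ x, φ x = 0 → ‖(S ^ n) x‖ ≤ ε * ‖x‖ := by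
  have hM0 : 0 ≤ M := (norm_nonneg _).trans (hM 0)
  have hhn : 0 < ‖h‖ := norm_pos_iff.2 hh.ne'
  have hφpos : ∀ f, 0 ≤ f → 0 ≤ φ f := fun f hf => le_trans (by positivity) (hφδ f hf)
  have hφh : 0 < φ h := lt_of_lt_of_le (by positivity) (hφδ h hh.le)
  obtain ⟨K, hK, hφK⟩ : ∃ K : ℝ, 0 < K ∧ ∀ x, φ x ≤ K * ‖x‖ :=
    ⟨‖φ‖ + 1, by positivity, fun x => by
      linarith [(le_abs_self _).trans (φ.le_opNorm x), norm_nonneg x]⟩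
  have hmono : ∀ {a b : E}, a ≤ b → φ a ≤ φ b := fun hab => by
    have := hφpos _ (sub_nonneg.2 hab)
    rw [map_sub] at this
    linarith
  -- The common part `(φ x⁺ / K) • h` has mass `2 * η * φ x⁺`. Removing it twice gains `4 * η * φ
  -- x⁺`; the errors give back at most half of this.
  set η : ℝ := φ h / K / 2 with hη
  have hη0 : 0 < η := by positivity
  obtain ⟨n, hn⟩ := (hS (η * δ / (2 * K)) (by positivity)).exists
  have hone : ∀ f, 0 ≤ f → ∃ e, 0 ≤ e ∧ 0 ≤ ((S ^ n) f - (φ f / K) • h) + e ∧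
      φ e ≤ η / 2 * φ f := by
    intro f hf
    obtain ⟨e, he, hen, hle⟩ := hn f hf
    refine ⟨e, he, ?_, ?_⟩
    · have h1 : (φ f / K) • h ≤ ‖f‖ • h :=
        smul_le_smul_of_nonneg_right ((div_le_iff₀' hK).2 (hφK f)) hh.le
      have h2 := sub_nonneg.2 (h1.trans hle)
      rwa [add_sub_right_comm] at h2
    · calc φ e ≤ K * ‖e‖ := hφK e
        _ ≤ K * (η * δ / (2 * K) * ‖f‖) := mul_le_mul_of_nonneg_left hen hK.le
        _ = η / 2 * (δ * ‖f‖) := by field_simp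
        _ ≤ η / 2 * φ f := mul_le_mul_of_nonneg_left (hφδ f hf) (by positivity)
  -- Truncated because `1 - η` is not known to be nonnegative.
  set q : ℝ := max (1 - η) 0 with hq
  have hq0 : 0 ≤ q := le_max_right _ _
  have hq1 : q < 1 := max_lt (by linarith) one_pos
  have hcontr : ∀ x, φ x = 0 → φ |(S ^ n) x| ≤ q * φ |x| := by
    intro x hx
    obtain ⟨e, he, hpe, hφe⟩ := hone x⁺ (posPart_nonneg x)
    obtain ⟨d, hd, hpd, hφd⟩ := hone x⁻ (negPart_nonneg x)
    have hpm : φ x⁻ = φ x⁺ := by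
      have := congrArg φ (posPart_sub_negPart x)
      rw [map_sub, hx] at this
      linarith
    have habs : φ |x| = 2 * φ x⁺ := by
      rw [← posPart_add_negPart, map_add, hpm]; ring
    have hSx : (S ^ n) x
        = ((S ^ n) x⁺ - (φ x⁺ / K) • h) - ((S ^ n) x⁻ - (φ x⁻ / K) • h) := by
      rw [hpm, sub_sub_sub_cancel_right, ← map_sub, posPart_sub_negPart]
    have h1 : φ |(S ^ n) x| ≤ (1 - η) * φ |x| := by
      rw [hSx]
      refine (hmono (abs_sub_le_of_nonneg_add he hd hpe hpd)).trans ?_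
      simp only [map_add, map_sub, map_smul, smul_eq_mul, apply_pow_of_comp_eq hφS]
      rw [hpm] at hφd ⊢
      have h2 : φ x⁺ / K * φ h = 2 * η * φ x⁺ := by rw [hη]; field_simp
      rw [h2, habs]
      linarith
    exact h1.trans (mul_le_mul_of_nonneg_right (le_max_left _ _) (hφpos _ (abs_nonneg x)))
  have hiter : ∀ k x, φ x = 0 → φ |(S ^ (n * k)) x| ≤ q ^ k * φ |x| := by
    intro k
    induction k with
    | zero => intro x _; simp
    | succ k ih =>
      intro x hx
      rw [Nat.mul_succ, pow_add]
      refine (ih ((S ^ n) x) (by rw [apply_pow_of_comp_eq hφS, hx])).trans ?_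
      rw [pow_succ, mul_assoc]
      exact mul_le_mul_of_nonneg_left (hcontr x hx) (by positivity)
  have hqlim : Tendsto (fun k : ℕ => M * (q ^ k * K / δ)) atTop (𝓝 0) := by
    have := (((tendsto_pow_atTop_nhds_zero_of_lt_one hq0 hq1).mul_const K).div_const δ).const_mul M
    simpa using this
  obtain ⟨k, hk⟩ := (hqlim.eventually (gt_mem_nhds hε)).exists
  filter_upwards [eventually_ge_atTop (n * k)] with m hm x hx
  have h1 : ‖(S ^ (n * k)) x‖ ≤ q ^ k * K / δ * ‖x‖ := by
    have h2 := hφδ _ (abs_nonneg ((S ^ (n * k)) x))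
    have h3 := hφK |x|
    rw [norm_abs_eq_norm] at h2 h3
    rw [div_mul_eq_mul_div, le_div_iff₀' hδ, mul_assoc]
    exact (h2.trans (hiter k x hx)).trans (mul_le_mul_of_nonneg_left h3 (by positivity))
  obtain ⟨j, rfl⟩ := Nat.exists_eq_add_of_le' hm
  rw [pow_add]
  calc ‖(S ^ j) ((S ^ (n * k)) x)‖ ≤ M * ‖(S ^ (n * k)) x‖ := (S ^ j).le_of_opNorm_le (hM j) _
    _ ≤ M * (q ^ k * K / δ * ‖x‖) := mul_le_mul_of_nonneg_left h1 hM0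
    _ = M * (q ^ k * K / δ) * ‖x‖ := by ring
    _ ≤ ε * ‖x‖ := mul_le_mul_of_nonneg_right hk.le (norm_nonneg _)

/-- A power-bounded operator on an AL-space whose powers have a nonzero asymptotic lower bound
converges in norm to a rank-one projection. -/
theorem exists_tendsto_pow_rankOne [CompleteSpace E] [IsALSpace E] {S : E →L[ℝ] E} {M : ℝ}
    (hM : ∀ n, ‖S ^ n‖ ≤ M) {h : E} (hh : 0 < h)
    (hS : AsymptoticLowerBound (fun n : ℕ => S ^ n) atTop h) :
    ∃ (f₀ : E) (φ : E →L[ℝ] ℝ), 0 ≤ f₀ ∧ ‖f₀‖ = 1 ∧ (∀ f, 0 ≤ f → 0 ≤ φ f) ∧ φ f₀ = 1 ∧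
      (∃ ε : ℝ, 0 < ε ∧ ∀ f, 0 ≤ f → ‖f‖ = 1 → ε ≤ φ f) ∧
      Tendsto (fun n : ℕ => S ^ n) atTop (𝓝 (φ.smulRight f₀)) := by
  have hhn : 0 < ‖h‖ := norm_pos_iff.2 hh.ne'
  obtain ⟨φ, hφS, hφδ⟩ := exists_invariant_functional_of_asymptoticLowerBound hM hh hS
  have hφh : 0 < φ h := lt_of_lt_of_le (by positivity) (hφδ h hh.le)
  have hker := fun {ε : ℝ} (hε : 0 < ε) =>
    eventually_norm_pow_apply_le_of_ker hM hh hS hφS (half_pos hhn) hφδ hε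
  set g : E := (φ h)⁻¹ • h with hg
  have hg0 : 0 ≤ g := smul_nonneg (inv_nonneg.2 hφh.le) hh.le
  have hφg : φ g = 1 := by rw [hg, map_smul, smul_eq_mul, inv_mul_cancel₀ hφh.ne']
  have hcauchy : CauchySeq fun n : ℕ => (S ^ n) g := by
    refine Metric.cauchySeq_iff'.2 fun ε hε => ?_
    have hB : 0 < M * ‖g‖ + ‖g‖ + 1 := by
      have := (norm_nonneg _).trans (hM 0)
      positivity
    -- `(S ^ j) g - g` lies in `ker φ` and is bounded uniformly in `j`.
    obtain ⟨N, hN⟩ := (hker (div_pos hε hB)).exists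
    refine ⟨N, fun n hn => ?_⟩
    obtain ⟨j, rfl⟩ := Nat.exists_eq_add_of_le hn
    rw [dist_eq_norm, pow_add]
    change ‖(S ^ N) ((S ^ j) g) - (S ^ N) g‖ < ε
    rw [← map_sub]
    refine (hN _ (by rw [map_sub, apply_pow_of_comp_eq hφS, sub_self])).trans_lt ?_
    rw [div_mul_eq_mul_div, div_lt_iff₀ hB]
    refine mul_lt_mul_of_pos_left ?_ hε
    linarith [norm_sub_le ((S ^ j) g) g, (S ^ j).le_of_opNorm_le (hM j) g]
  obtain ⟨f₁, hf₁⟩ := cauchySeq_tendsto_of_complete hcauchy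
  have hφf₁ : φ f₁ = 1 := by
    refine tendsto_nhds_unique ((φ.continuous.tendsto f₁).comp hf₁) ?_
    simp only [Function.comp_def, apply_pow_of_comp_eq hφS, hφg, tendsto_const_nhds]
  have hSf₁ : ∀ n, (S ^ n) f₁ = f₁ := by
    intro n
    refine tendsto_nhds_unique (((S ^ n).continuous.tendsto f₁).comp hf₁) ?_
    refine ((tendsto_add_atTop_iff_nat n).2 hf₁).congr fun m => ?_
    rw [add_comm, pow_add]
    rfl
  -- `S` need not be positive, but the lower bound makes the negative parts of `(S ^ n) g` vanish in
  -- the limit.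
  have hf₁0 : 0 ≤ f₁ := by
    rw [← negPart_eq_zero, ← norm_le_zero_iff]
    refine le_of_forall_pos_le_add fun ε hε => ?_
    rw [zero_add]
    refine le_of_tendsto (((continuous_negPart.tendsto f₁).comp hf₁).norm) ?_
    filter_upwards [hS (ε / (‖g‖ + 1)) (by positivity)] with n hn
    obtain ⟨e, he, hen, hle⟩ := hn g hg0
    have h1 := negPart_le_of_le_add he
      ((smul_nonneg (norm_nonneg g) hh.le).trans hle)
    rw [sub_zero] at h1
    refine (norm_le_norm_of_nonneg_of_le (negPart_nonneg _) h1).trans (hen.trans ?_)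
    rw [div_mul_eq_mul_div, div_le_iff₀ (by positivity)]
    exact mul_le_mul_of_nonneg_left (by linarith) hε.le
  have hf₁ne : f₁ ≠ 0 := fun h0 => by simp [h0] at hφf₁
  have hf₁n : 0 < ‖f₁‖ := norm_pos_iff.2 hf₁ne
  have hφpos : ∀ f, 0 ≤ f → 0 ≤ φ f := fun f hf => le_trans (by positivity) (hφδ f hf)
  -- Reciprocal scalings normalise `f₁` and leave the projection unchanged.
  refine ⟨‖f₁‖⁻¹ • f₁, ‖f₁‖ • φ, smul_nonneg (by positivity) hf₁0, ?_, fun f hf => ?_, ?_,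
    ⟨‖f₁‖ * (‖h‖ / 2), by positivity, fun f hf hfn => ?_⟩, ?_⟩
  · rw [norm_smul, norm_inv, norm_norm, inv_mul_cancel₀ hf₁n.ne']
  · exact mul_nonneg hf₁n.le (hφpos f hf)
  · simp [hφf₁, hf₁n.ne']
  · have h1 := hφδ f hf
    rw [hfn, mul_one] at h1
    exact mul_le_mul_of_nonneg_left h1 hf₁n.le
  · have hP : (‖f₁‖ • φ).smulRight (‖f₁‖⁻¹ • f₁) = φ.smulRight f₁ := by
      ext x
      simp only [ContinuousLinearMap.smulRight_apply, smul_apply, smul_smul,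
        smul_eq_mul]
      congr 1
      field_simp
    rw [hP, Metric.tendsto_nhds]
    intro ε hε
    filter_upwards [hker (ε := ε / 2 / (1 + ‖φ‖ * ‖f₁‖)) (by positivity)] with n hn
    rw [dist_eq_norm]
    refine lt_of_le_of_lt (ContinuousLinearMap.opNorm_le_bound _ (half_pos hε).le fun x => ?_)
      (half_lt_self hε)
    have h1 : (S ^ n - φ.smulRight f₁) x = (S ^ n) (x - φ x • f₁) := by
      rw [map_sub, map_smul, hSf₁]
      rfl
    rw [h1]
    refine (hn _ (by rw [map_sub, map_smul, hφf₁, smul_eq_mul, mul_one, sub_self])).trans ?_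
    rw [div_mul_eq_mul_div, div_le_iff₀ (by positivity), mul_assoc]
    refine mul_le_mul_of_nonneg_left ?_ (half_pos hε).le
    have h2 : ‖φ x • f₁‖ ≤ ‖φ‖ * ‖x‖ * ‖f₁‖ := by
      rw [norm_smul]
      exact mul_le_mul_of_nonneg_right (φ.le_opNorm x) (norm_nonneg _)
    linarith [norm_sub_le x (φ x • f₁)]

end PowerConvergence

/-! ### From powers to semigroups -/

section Semigroups

variable {E : Type*} [NormedAddCommGroup E] [NormedSpace ℝ E]

theorem IsBoundedSemigroup.exists_pow_succ_eq {J : Type*} [Add J] {T : J → E →L[ℝ] E}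
    (hT : IsBoundedSemigroup T) (t : J) (n : ℕ) : ∃ s, T t ^ (n + 1) = T s := by
  induction n with
  | zero => exact ⟨t, by rw [zero_add, pow_one]⟩
  | succ n ih =>
    obtain ⟨s, hs⟩ := ih
    exact ⟨s + t, by rw [pow_succ, hs, hT.map_add]; rfl⟩

theorem IsBoundedSemigroup.exists_norm_le {J : Type*} [Add J] {T : J → E →L[ℝ] E}
    (hT : IsBoundedSemigroup T) : ∃ M : ℝ, 0 ≤ M ∧ ∀ t, ‖T t‖ ≤ M := by
  obtain ⟨M, hM⟩ := hT.bddAbove_norm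
  exact ⟨max M 0, le_max_right _ _, fun t => (hM ⟨t, rfl⟩).trans (le_max_left _ _)⟩

theorem IsBoundedSemigroup.exists_norm_pow_le {J : Type*} [Add J] {T : J → E →L[ℝ] E}
    (hT : IsBoundedSemigroup T) : ∃ M : ℝ, ∀ t n, ‖T t ^ n‖ ≤ M := by
  obtain ⟨M, -, hM⟩ := hT.exists_norm_le
  -- The zeroth power is the identity, which need not belong to the semigroup.
  refine ⟨max M ‖(1 : E →L[ℝ] E)‖, fun t n => ?_⟩
  cases n with
  | zero => rw [pow_zero]; exact le_max_right _ _
  | succ n =>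
    obtain ⟨s, hs⟩ := hT.exists_pow_succ_eq t n
    rw [hs]
    exact (hM s).trans (le_max_left _ _)

theorem IsBoundedSemigroup.pow_eq_pnat {T : ℕ+ → E →L[ℝ] E} (hT : IsBoundedSemigroup T)
    (n : ℕ+) : T 1 ^ (n : ℕ) = T n := by
  induction n with
  | one => simp
  | succ n ih =>
    rw [PNat.add_coe, PNat.one_coe, pow_succ, ih, hT.map_add]
    rfl

theorem IsBoundedSemigroup.pow_eq_posReal {T : {t : ℝ // 0 < t} → E →L[ℝ] E}
    (hT : IsBoundedSemigroup T) (n : ℕ) :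
    T ⟨1, one_pos⟩ ^ (n + 1) = T ⟨(n : ℝ) + 1, by positivity⟩ := by
  induction n with
  | zero => simp
  | succ n ih =>
    rw [pow_succ, ih]
    refine (hT.map_add _ _).symm.trans (congrArg T (Subtype.ext ?_))
    push_cast
    rfl

/-- If the operators at integer times converge to a rank-one projection, then its range and its
functional are fixed by every operator of the semigroup. -/
theorem IsBoundedSemigroup.posReal_fixed {T : {t : ℝ // 0 < t} → E →L[ℝ] E}
    (hT : IsBoundedSemigroup T) {f₀ : E} {φ : E →L[ℝ] ℝ} (hφf₀ : φ f₀ = 1)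
    (hlim : Tendsto (fun n : ℕ => T ⟨1, one_pos⟩ ^ n) atTop (𝓝 (φ.smulRight f₀))) :
    (∀ t, T t f₀ = f₀) ∧ ∀ t, φ.comp (T t) = φ := by
  have hf₀ : f₀ ≠ 0 := fun h0 => by simp [h0] at hφf₀
  have happ := tendsto_pow_apply hlim
  have hcomm : ∀ t x, T t (φ x • f₀) = φ (T t x) • f₀ := by
    intro t x
    refine tendsto_nhds_unique (((T t).continuous.tendsto _).comp (happ x)) ?_
    refine (happ (T t x)).congr fun n => ?_
    have hc : Commute (T t) (T ⟨1, one_pos⟩) := by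
      change (T t).comp _ = (T _).comp _
      rw [← hT.map_add, ← hT.map_add, add_comm]
    exact (DFunLike.congr_fun (hc.pow_right n).eq x).symm
  have hmul : ∀ t, T t f₀ = φ (T t f₀) • f₀ := fun t => by
    have := hcomm t f₀
    rwa [hφf₀, one_smul] at this
  have hadd : ∀ s t, φ (T (s + t) f₀) = φ (T s f₀) * φ (T t f₀) := by
    intro s t
    rw [hT.map_add, ContinuousLinearMap.comp_apply, hmul t, map_smul, map_smul, smul_eq_mul,
      map_smul, hφf₀]
    simp [mul_comm]
  have hnonneg : ∀ t, 0 ≤ φ (T t f₀) := by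
    intro t
    have ht : t = ⟨t.1 / 2, half_pos t.2⟩ + ⟨t.1 / 2, half_pos t.2⟩ :=
      Subtype.ext (add_halves t.1).symm
    rw [ht, hadd]
    exact mul_self_nonneg _
  obtain ⟨M, hM⟩ := hT.exists_norm_pow_le
  have hle : ∀ t, φ (T t f₀) ≤ 1 := by
    intro t
    by_contra! hlt
    have hpow : ∀ n : ℕ, (T t ^ n) f₀ = φ (T t f₀) ^ n • f₀ := by
      intro n
      induction n with
      | zero => simp
      | succ n ih =>
        rw [pow_succ']
        change T t ((T t ^ n) f₀) = _
        rw [ih, map_smul, hmul t, map_smul, hφf₀, smul_smul, smul_eq_mul, mul_one, pow_succ]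
    obtain ⟨n, hn⟩ := pow_unbounded_of_one_lt M hlt
    have h1 := (T t ^ n).le_of_opNorm_le (hM t n) f₀
    rw [hpow, norm_smul, Real.norm_of_nonneg (pow_nonneg (hnonneg t) n)] at h1
    exact absurd (le_of_mul_le_mul_right h1 (norm_pos_iff.2 hf₀)) (not_le.2 hn)
  have hint : ∀ n : ℕ, φ (T ⟨(n : ℝ) + 1, by positivity⟩ f₀) = 1 := by
    intro n
    rw [← hT.pow_eq_posReal, pow_apply_of_apply_eq (fixed_of_tendsto_pow_rankOne hφf₀ hlim).1,
      hφf₀]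
  -- The scalars at `t` and `n + 1 - t` lie in `[0, 1]` and have product 1.
  have hone : ∀ t, φ (T t f₀) = 1 := by
    intro t
    refine le_antisymm (hle t) ?_
    obtain ⟨n, hn⟩ := exists_nat_gt t.1
    have hs : 0 < (n : ℝ) + 1 - t.1 := by linarith
    have h1 := hadd ⟨(n : ℝ) + 1 - t.1, hs⟩ t
    have h2 : (⟨(n : ℝ) + 1 - t.1, hs⟩ + t : {t : ℝ // 0 < t}) = ⟨(n : ℝ) + 1, by positivity⟩ :=
      Subtype.ext (sub_add_cancel _ _)
    rw [h2, hint] at h1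
    rw [h1]
    exact mul_le_of_le_one_left (hnonneg t) (hle _)
  have hfix : ∀ t, T t f₀ = f₀ := fun t => by rw [hmul t, hone t, one_smul]
  refine ⟨hfix, fun t => ?_⟩
  ext x
  have h1 := congrArg φ (hcomm t x)
  rw [map_smul, hfix, map_smul, map_smul, hφf₀] at h1
  simpa using h1.symm

variable [Lattice E] [IsOrderedAddMonoid E] [IsOrderedModule ℝ E] [HasSolidNorm E]
  [CompleteSpace E] [IsALSpace E]

theorem IsBoundedSemigroup.convergesInNormToRankOne_pnat {T : ℕ+ → E →L[ℝ] E}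
    (hT : IsBoundedSemigroup T) (hlow : HasUniformLowerBound T) : ConvergesInNormToRankOne T := by
  obtain ⟨h, hh, hlim⟩ := hlow
  obtain ⟨M, -, hM⟩ := hT.exists_norm_le
  obtain ⟨M', hM'⟩ := hT.exists_norm_pow_le
  have hlb := AsymptoticLowerBound.of_tendsto_sSup hM hlim
  have hS : AsymptoticLowerBound (fun n : ℕ => T 1 ^ n) atTop h := by
    intro ε hε
    obtain ⟨N, hN⟩ := eventually_atTop.1 (hlb ε hε)
    filter_upwards [eventually_ge_atTop (N : ℕ)] with n hn
    lift n to ℕ+ using N.pos.trans_le hn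
    rw [hT.pow_eq_pnat]
    exact hN n hn
  obtain ⟨f₀, φ, hf₀, hf₁, hφ, hφf₀, hε, hconv⟩ := exists_tendsto_pow_rankOne (hM' 1) hh hS
  obtain ⟨hfix, hφfix⟩ := fixed_of_tendsto_pow_rankOne hφf₀ hconv
  refine ⟨f₀, φ, hf₀, hf₁, fun t => ?_, hφ, fun t => ?_, hφf₀, hε, ?_⟩
  · rw [← hT.pow_eq_pnat, pow_apply_of_apply_eq hfix]
  · ext x
    rw [← hT.pow_eq_pnat]
    exact apply_pow_of_comp_eq hφfix t x
  · exact (hconv.comp tendsto_PNat_val_atTop_atTop).congr fun n => hT.pow_eq_pnat n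

theorem IsBoundedSemigroup.convergesInNormToRankOne_posReal {T : {t : ℝ // 0 < t} → E →L[ℝ] E}
    (hT : IsBoundedSemigroup T) (hlow : HasUniformLowerBound T) : ConvergesInNormToRankOne T := by
  obtain ⟨h, hh, hlim⟩ := hlow
  obtain ⟨M, hM0, hM⟩ := hT.exists_norm_le
  obtain ⟨M', hM'⟩ := hT.exists_norm_pow_le
  have hlb := AsymptoticLowerBound.of_tendsto_sSup hM hlim
  have hS : AsymptoticLowerBound (fun n : ℕ => T ⟨1, one_pos⟩ ^ n) atTop h := by
    intro ε hε
    obtain ⟨N, hN⟩ := eventually_atTop.1 (hlb ε hε)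
    filter_upwards [eventually_ge_atTop (⌈N.1⌉₊ + 1)] with n hn
    obtain ⟨k, rfl⟩ := Nat.exists_eq_add_of_le' (le_of_add_le_right hn)
    have h1 := hN ⟨(k : ℝ) + 1, by positivity⟩ (by
      change N.1 ≤ (k : ℝ) + 1
      have h2 : (⌈N.1⌉₊ : ℝ) ≤ k := by exact_mod_cast (by omega : ⌈N.1⌉₊ ≤ k)
      linarith [Nat.le_ceil N.1])
    rwa [← hT.pow_eq_posReal] at h1
  obtain ⟨f₀, φ, hf₀, hf₁, hφ, hφf₀, hε, hconv⟩ := exists_tendsto_pow_rankOne (hM' _) hh hS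
  obtain ⟨hfix, hφfix⟩ := hT.posReal_fixed hφf₀ hconv
  refine ⟨f₀, φ, hf₀, hf₁, hfix, hφ, hφfix, hφf₀, hε, ?_⟩
  rw [Metric.tendsto_nhds]
  intro ε hε
  obtain ⟨N, hN⟩ := Metric.tendsto_atTop.1 hconv (ε / (M + 1)) (by positivity)
  -- Two units beyond `N`, so that the remaining time `t - (N + 1)` is strictly positive: there is
  -- no time 0.
  filter_upwards [eventually_ge_atTop (⟨(N : ℝ) + 2, by positivity⟩ : {t : ℝ // 0 < t})] with t ht
  have ht' : (N : ℝ) + 2 ≤ t.1 := ht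
  have hs : 0 < t.1 - ((N : ℝ) + 1) := by linarith
  have h1 : T t - φ.smulRight f₀
      = (T ⟨t.1 - ((N : ℝ) + 1), hs⟩).comp (T ⟨1, one_pos⟩ ^ (N + 1) - φ.smulRight f₀) := by
    have h2 : t = ⟨t.1 - ((N : ℝ) + 1), hs⟩ + ⟨(N : ℝ) + 1, by positivity⟩ :=
      Subtype.ext (sub_add_cancel _ _).symm
    ext x
    conv_lhs => rw [h2, hT.map_add]
    simp [hT.pow_eq_posReal, hfix]
  rw [dist_eq_norm, h1]
  have h3 := hN (N + 1) (Nat.le_succ N)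
  rw [dist_eq_norm, lt_div_iff₀ (by positivity)] at h3
  refine (ContinuousLinearMap.opNorm_comp_le _ _).trans_lt ?_
  refine (mul_le_mul_of_nonneg_right (hM _) (norm_nonneg _)).trans_lt (lt_of_le_of_lt ?_ h3)
  linarith [norm_nonneg (T ⟨1, one_pos⟩ ^ (N + 1) - φ.smulRight f₀)]

end Semigroups

theorem corollary3p6 {E : Type*} [NormedAddCommGroup E] [NormedSpace ℝ E] [CompleteSpace E]
    [Lattice E] [IsOrderedAddMonoid E] [IsOrderedModule ℝ E] [HasSolidNorm E] [IsALSpace E] :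
    (∀ T : ℕ+ → E →L[ℝ] E, IsBoundedSemigroup T →
      (ConvergesInNormToRankOne T ↔ HasUniformLowerBound T)) ∧
    (∀ T : {t : ℝ // 0 < t} → E →L[ℝ] E, IsBoundedSemigroup T →
      (ConvergesInNormToRankOne T ↔ HasUniformLowerBound T)) :=
  ⟨fun _ hT => ⟨fun h => h.hasUniformLowerBound, hT.convergesInNormToRankOne_pnat⟩,
    fun _ hT => ⟨fun h => h.hasUniformLowerBound, hT.convergesInNormToRankOne_posReal⟩⟩
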